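/- There is a universal constant $C>0$ such that for every metric space $(M,d)$ there is a deterministic online algorithm for chasing small sets in $M$ (metrical service systems) that is $C\cdot 2^k$-competitive for chasing sets of cardinality at most $k$, simultaneously for every $k$. In other words, there exists an $O(2^k)$-competitive deterministic algorithm for chasing sets of cardinality at most $k$. Here the player starts at a given point $s_0\in M$. At each time $t=1,\dots,T$ a set $S_t\subseteq M$ with $1\le |S_t|\le k$ is revealed, and the algorithm must choose a point $s_t\in S_t$ depending only on $s_0$ and $S_1,\dots,S_t$ (it knows neither $T$ nor $k$), paying $d(s_{t-1},s_t)$. The algorithm is called $\rho$-competitive if, for every $s_0$ and every such finite sequence of requests, $$\sum_{t=1}^T d(s_{t-1},s_t)\;\le\;\rho\cdot\min\Big\{\sum_{t=1}^T d(x_{t-1},x_t)\;\Big|\;x_0=s_0,\ x_1\in S_1,\dots,x_T\in S_T\Big\}.$$ -/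

import Mathlib

namespace SmallSetChasing

/-- The total distance travelled along the points `x 0, x 1, …, x T`. -/
noncomputable def travelCost {M : Type*} [MetricSpace M] {T : ℕ} (x : Fin (T + 1) → M) : ℝ :=
  ∑ t : Fin T, dist (x t.castSucc) (x t.succ)

/-- The trajectory `x` starts at `s₀` and serves every request: its position after the
`t`-th request lies in the `t`-th requested set (here `S t` is the request number `t + 1`). -/
def Serves {M : Type*} {T : ℕ} (s₀ : M) (S : Fin T → Finset M) (x : Fin (T + 1) → M) : Prop :=
  x 0 = s₀ ∧ ∀ t : Fin T, x t.succ ∈ S t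

/-- The offline optimum: the least cost of a trajectory that serves all requests. -/
noncomputable def offlineOpt {M : Type*} [MetricSpace M] {T : ℕ} (s₀ : M)
    (S : Fin T → Finset M) : ℝ :=
  sInf {c : ℝ | ∃ x : Fin (T + 1) → M, Serves s₀ S x ∧ travelCost x = c}

/-- When all requests are nonempty, the infimum in `offlineOpt` is an attained minimum. -/
theorem offlineOpt_isLeast {M : Type*} [MetricSpace M] {T : ℕ} (s₀ : M)
    (S : Fin T → Finset M) (hS : ∀ t, (S t).Nonempty) :
    IsLeast {c : ℝ | ∃ x : Fin (T + 1) → M, Serves s₀ S x ∧ travelCost x = c}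
      (offlineOpt s₀ S) := by
  classical
  have hfin : {x : Fin (T + 1) → M | Serves s₀ S x}.Finite := by
    refine Set.Finite.subset (Fintype.piFinset
      (fun i : Fin (T + 1) => (Fin.cases {s₀} S i : Finset M))).finite_toSet ?_
    rintro x ⟨h0, h1⟩
    rw [Finset.mem_coe, Fintype.mem_piFinset]
    intro i
    refine Fin.cases ?_ (fun t => ?_) i
    · simpa using h0
    · simpa using h1 t
  have hset : {c : ℝ | ∃ x : Fin (T + 1) → M, Serves s₀ S x ∧ travelCost x = c}
      = travelCost '' {x : Fin (T + 1) → M | Serves s₀ S x} := rfl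
  choose y hy using hS
  have hne : {x : Fin (T + 1) → M | Serves s₀ S x}.Nonempty :=
    ⟨Fin.cons s₀ y, by simp [Serves, hy]⟩
  unfold offlineOpt
  rw [hset]
  have hf := hfin.image (travelCost (M := M) (T := T))
  exact ⟨(hne.image _).csInf_mem hf, fun c hc => csInf_le hf.bddBelow hc⟩

/-- A deterministic online algorithm for chasing sets in `M`. Given the initial position, the
list of the past requests (in chronological order) and the current request, it chooses the next
position, which has to lie in the current request. The earlier positions of the player are
determined by these data, so that they need not be passed on. Neither the number of
requests nor a bound on their cardinalities is available to the algorithm. -/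
structure OnlineAlgorithm (M : Type*) where
  /-- the next position, from initial position, past requests and current request -/
  next : M → List (Finset M) → Finset M → M
  next_mem : ∀ (s₀ : M) (past : List (Finset M)) (S : Finset M),
    S.Nonempty → next s₀ past S ∈ S

/-- The positions of the player who follows the algorithm on the requests `S`. -/
def OnlineAlgorithm.run {M : Type*} (A : OnlineAlgorithm M) {T : ℕ} (s₀ : M)
    (S : Fin T → Finset M) : Fin (T + 1) → M :=
  Fin.cons s₀ fun t : Fin T => A.next s₀ ((List.ofFn S).take t) (S t)

/-- The algorithm is `ρ`-competitive for chasing sets of cardinality at most `k`: for every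
initial position and every finite sequence of nonempty requests of cardinality at most `k`, its
cost is at most `ρ` times the offline optimum. -/
def OnlineAlgorithm.IsCompetitive {M : Type*} [MetricSpace M] (A : OnlineAlgorithm M)
    (k : ℕ) (ρ : ℝ) : Prop :=
  ∀ (s₀ : M) (T : ℕ) (S : Fin T → Finset M), (∀ t, 1 ≤ (S t).card ∧ (S t).card ≤ k) →
    travelCost (A.run s₀ S) ≤ ρ * offlineOpt s₀ S

end SmallSetChasing

/-! Suppose first that `k` is known. The player keeps a tree whose leaves are the points of the last
request. The depth of a leaf is the least cost of serving all requests and ending there. The player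
stands at the leaf reached along active branches. Levels start at `k` and drop by one at each fork;
as there are at most `k` leaves, they do not run out.

The potential `pot` plays three roles. It bounds the distance from the root to the player
(`dist_pos_le_pot`). It is at most `exp 3` times the depth of any leaf, hence at most `exp 3` times
the optimum (`pot_le_of_mem_leaves`, `gam_le`, `exists_leaf_le_pathCost`). Each move is at most `192
* 2 ^ k` times its growth (`dist_pos_step_le`).

For the last point, a fork passes on at least half of the growth of its active branch, which is the
source of `2 ^ k`. Switching branches gains `eps ^ 2` times the value of the new active branch. When
a branch dies, the survivor rises one level and gains a factor `1 + (3/4) ^ j` (`pot_succ_ge`), more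
than the factor `1 + 5/2 * eps j` by which the fork could exceed it. The rate `3/4` fits: `2 ^ j *
eps j ^ 2` stays bounded below, while the product of the factors `1 + (3/4) ^ j` converges.

For unknown `k`, the player follows the algorithm for the largest cardinality so far; the costs of
changing algorithms sum geometrically. -/

namespace SmallSetChasing

/-! ### Combining the values of two branches -/

/-- The value of a fork whose active and inactive branch have the values `a` and `o`: both are
capped relative to each other, and the inactive branch gets the extra weight `e`. -/
noncomputable def comb (e a o : ℝ) : ℝ :=
  (min a ((1 + e) * o) + min o ((1 + e) * a)) / 2 + e * min o ((1 + e) * a)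

theorem comb_mono {e a o a' o' : ℝ} (he : 0 ≤ e) (ha : a ≤ a') (ho : o ≤ o') :
    comb e a o ≤ comb e a' o' := by
  have h1 : min a ((1 + e) * o) ≤ min a' ((1 + e) * o') :=
    min_le_min ha (mul_le_mul_of_nonneg_left ho (by linarith))
  have h2 : min o ((1 + e) * a) ≤ min o' ((1 + e) * a') :=
    min_le_min ho (mul_le_mul_of_nonneg_left ha (by linarith))
  have h3 := mul_le_mul_of_nonneg_left h2 he
  unfold comb
  linarith

theorem comb_nonneg {e a o : ℝ} (he : 0 ≤ e) (ha : 0 ≤ a) (ho : 0 ≤ o) : 0 ≤ comb e a o := by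
  have h := comb_mono he ha ho
  simpa [comb] using h

/-- The extra weight `e` on the inactive branch makes up for its being possibly smaller by a factor
`1 + e`, since `1 / 2 + e ≥ (1 + e) / 2`. -/
theorem le_comb {e a o : ℝ} (he : 0 ≤ e) (ha : 0 ≤ a) (h : a ≤ (1 + e) * o) :
    a ≤ comb e a o := by
  have h1 : a ≤ (1 + e) * min o ((1 + e) * a) := by
    rw [mul_min_of_nonneg _ _ (by linarith)]
    refine le_min h ?_
    nlinarith [mul_nonneg he ha, mul_nonneg he (mul_nonneg he ha)]
  have h2 : 0 ≤ min o ((1 + e) * a) := by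
    by_contra hn
    push Not at hn
    nlinarith
  have h3 : 0 ≤ e * min o ((1 + e) * a) := mul_nonneg he h2
  unfold comb
  rw [min_eq_left h]
  linarith

/-- This is what the caps are for: either branch alone controls the fork, so either may be deleted.
-/
theorem comb_le_left {e a o : ℝ} (he : 0 ≤ e) (he1 : e ≤ 1) (ha : 0 ≤ a) :
    comb e a o ≤ (1 + 5 / 2 * e) * a := by
  have h1 : min a ((1 + e) * o) ≤ a := min_le_left _ _
  have h2 : min o ((1 + e) * a) ≤ (1 + e) * a := min_le_right _ _
  have h3 := mul_le_mul_of_nonneg_left h2 he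
  have h4 : e * (e * a) ≤ 1 * (e * a) :=
    mul_le_mul_of_nonneg_right he1 (mul_nonneg he ha)
  unfold comb
  linarith

theorem comb_le_right {e a o : ℝ} (he : 0 ≤ e) (ho : 0 ≤ o) :
    comb e a o ≤ (1 + 5 / 2 * e) * o := by
  have h1 : min a ((1 + e) * o) ≤ (1 + e) * o := min_le_right _ _
  have h2 : min o ((1 + e) * a) ≤ o := min_le_left _ _
  have h3 := mul_le_mul_of_nonneg_left h2 he
  have h4 := mul_nonneg he ho
  unfold comb
  linarith

/-- At this imbalance the symmetric part does not change. The extra weight moves from `o` to the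
larger value, capped at `(1 + e) * o`, which gains exactly `e * (e * o)`. -/
theorem comb_swap {e a o : ℝ} (he : 0 ≤ e) (ho : 0 ≤ o) (h : (1 + e) * o < a) :
    comb e a o + e * e * o ≤ comb e o a := by
  have h0 := mul_nonneg he ho
  have h1 : o ≤ (1 + e) * a := by nlinarith
  unfold comb
  rw [min_eq_right h.le, min_eq_left h1]
  linarith

/-- Induction step for `pot_succ_ge`. Raising the level lowers the threshold from `u / 6` to `u /
8`, which tightens the caps and shrinks the extra weight; the drop of the gain from `4 / 3 * u` to
`u` pays for both. -/
theorem one_add_mul_comb_le {u a o a' o' : ℝ} (hu : 0 ≤ u) (hu1 : u ≤ 1) (ha : 0 ≤ a)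
    (ho : 0 ≤ o) (ha' : (1 + 4 / 3 * u) * a ≤ a') (ho' : (1 + 4 / 3 * u) * o ≤ o') :
    (1 + u) * comb (u / 6) a o ≤ comb (u / 8) a' o' := by
  have key : ∀ x y x' y' : ℝ, 0 ≤ x → 0 ≤ y → (1 + 4 / 3 * u) * x ≤ x' →
      (1 + 4 / 3 * u) * y ≤ y' →
      (1 + 4 / 3 * u) * (1 + u / 8) * min x ((1 + u / 6) * y)
        ≤ (1 + u / 6) * min x' ((1 + u / 8) * y') := by
    intro x y x' y' hx hy hx' hy'
    rw [mul_min_of_nonneg x' _ (by linarith)]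
    have hm0 : 0 ≤ min x ((1 + u / 6) * y) := le_min hx (by positivity)
    refine le_min ?_ ?_
    · calc (1 + 4 / 3 * u) * (1 + u / 8) * min x ((1 + u / 6) * y)
          ≤ (1 + 4 / 3 * u) * (1 + u / 6) * x := by
            refine mul_le_mul ?_ (min_le_left _ _) hm0 (by positivity)
            exact mul_le_mul_of_nonneg_left (by linarith) (by positivity)
        _ = (1 + u / 6) * ((1 + 4 / 3 * u) * x) := by ring
        _ ≤ _ := mul_le_mul_of_nonneg_left hx' (by positivity)
    · calc (1 + 4 / 3 * u) * (1 + u / 8) * min x ((1 + u / 6) * y)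
          ≤ (1 + 4 / 3 * u) * (1 + u / 8) * ((1 + u / 6) * y) :=
            mul_le_mul_of_nonneg_left (min_le_right _ _) (by positivity)
        _ = (1 + u / 6) * ((1 + u / 8) * ((1 + 4 / 3 * u) * y)) := by ring
        _ ≤ _ := by gcongr
  have hX := key a o a' o' ha ho ha' ho'
  have hY := key o a o' a' ho ha ho' ha'
  unfold comb
  have hX0 : 0 ≤ min a ((1 + u / 6) * o) := le_min ha (by positivity)
  have hY0 : 0 ≤ min o ((1 + u / 6) * a) := le_min ho (by positivity)
  generalize min a ((1 + u / 6) * o) = X at *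
  generalize min o ((1 + u / 6) * a) = Y at *
  generalize min a' ((1 + u / 8) * o') = X' at *
  generalize min o' ((1 + u / 8) * a') = Y' at *
  have hc : (1 + u) * (1 + u / 6) ≤ (1 + 4 / 3 * u) * (1 + u / 8) := by nlinarith
  have hd : (1 + u) * (1 + u / 6) * (1 / 2 + u / 6)
      ≤ (1 + 4 / 3 * u) * (1 + u / 8) * (1 / 2 + u / 8) := by
    nlinarith [mul_nonneg hu (sub_nonneg.2 hu1), mul_nonneg (mul_nonneg hu hu) (sub_nonneg.2 hu1)]
  have hX2 := mul_le_mul_of_nonneg_right hc hX0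
  have hY2 := mul_le_mul_of_nonneg_right hd hY0
  have hY3 := mul_le_mul_of_nonneg_left hY (show 0 ≤ 1 / 2 + u / 8 by positivity)
  have hpos : 0 < 1 + u / 6 := by positivity
  refine le_of_mul_le_mul_left ?_ hpos
  linarith

/-! ### Thresholds and weights of the levels -/

/-- The switching threshold at level `j`. -/
noncomputable def eps (j : ℕ) : ℝ := (3 / 4) ^ j / 8

/-- The weight of a unit of depth at level `j`. -/
noncomputable def gam : ℕ → ℝ
  | 0 => 1
  | j + 1 => (1 + (3 / 4) ^ (j + 1)) * gam j

theorem eps_nonneg (j : ℕ) : 0 ≤ eps j := by unfold eps; positivity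

theorem eps_le (j : ℕ) : eps j ≤ 1 / 8 := by
  have := pow_le_one₀ (n := j) (show (0 : ℝ) ≤ 3 / 4 by norm_num) (by norm_num)
  unfold eps
  linarith

theorem one_le_gam (j : ℕ) : 1 ≤ gam j := by
  induction j with
  | zero => exact le_rfl
  | succ j ih =>
    have : (0 : ℝ) ≤ (3 / 4) ^ (j + 1) := by positivity
    unfold gam
    nlinarith

/-- The exponent in the induction is the partial sum of the geometric series `∑ (3/4) ^ i`, `i ≥ 1`,
with total `3`. -/
theorem gam_le (j : ℕ) : gam j ≤ Real.exp 3 := by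
  have h : gam j ≤ Real.exp (3 - 3 * (3 / 4) ^ j) := by
    induction j with
    | zero => simp [gam]
    | succ j ih =>
      have h1 : 1 + (3 / 4 : ℝ) ^ (j + 1) ≤ Real.exp ((3 / 4) ^ (j + 1)) := by
        linarith [Real.add_one_le_exp ((3 / 4 : ℝ) ^ (j + 1))]
      have h2 : (3 : ℝ) - 3 * (3 / 4) ^ (j + 1) = (3 / 4) ^ (j + 1) + (3 - 3 * (3 / 4) ^ j) := by
        ring
      rw [h2, Real.exp_add]
      unfold gam
      exact mul_le_mul h1 ih (by linarith [one_le_gam j]) (Real.exp_pos _).le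
  refine h.trans (Real.exp_le_exp.2 ?_)
  have : (0 : ℝ) ≤ (3 / 4) ^ j := by positivity
  linarith

/-! ### Trees and their potential -/

/-- Binary trees whose nodes carry a depth and a point. The first branch of a fork is the
active one. -/
inductive Tree (M : Type*) where
  | leaf (h : ℝ) (x : M) : Tree M
  | fork (h : ℝ) (p : M) (A O : Tree M) : Tree M

namespace Tree

variable {M : Type*}

/-- The leaves, as pairs of a point and a depth. -/
def leaves : Tree M → Multiset (M × ℝ)
  | leaf h x => {(x, h)}
  | fork _ _ A O => leaves A + leaves O

/-- The point of the leaf that is reached along active branches. -/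
def pos : Tree M → M
  | leaf _ x => x
  | fork _ _ A _ => pos A

/-- The potential of a tree at level `j`, hanging below a node of depth `h₀`. -/
noncomputable def pot : Tree M → ℕ → ℝ → ℝ
  | leaf h _, j, h₀ => gam j * (h - h₀)
  | fork h _ A O, j, h₀ => gam j * (h - h₀) + comb (eps j) (pot A (j - 1) h) (pot O (j - 1) h)

/-- The active branch of each fork is not much more expensive than the other one. -/
def Balanced : Tree M → ℕ → Prop
  | leaf _ _, _ => True
  | fork h _ A O, j => Balanced A (j - 1) ∧ Balanced O (j - 1) ∧
      pot A (j - 1) h ≤ (1 + eps j) * pot O (j - 1) h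

/-- A fork at level `j` whose branches are ordered so that it is balanced. -/
noncomputable def mk (j : ℕ) (h : ℝ) (p : M) (A O : Tree M) : Tree M :=
  open Classical in
  if pot A (j - 1) h ≤ (1 + eps j) * pot O (j - 1) h then fork h p A O else fork h p O A

theorem leaves_mk (j : ℕ) (h : ℝ) (p : M) (A O : Tree M) :
    (mk j h p A O).leaves = A.leaves + O.leaves := by
  unfold mk
  split_ifs
  · rfl
  · exact add_comm _ _

theorem card_leaves_pos (T : Tree M) : 0 < T.leaves.card := by
  induction T with
  | leaf h x => simp [leaves]
  | fork h p A O ihA ihO => simp [leaves]; omega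

theorem exists_leaf_pos (T : Tree M) : ∃ h, (T.pos, h) ∈ T.leaves := by
  induction T with
  | leaf h x => exact ⟨h, by simp [leaves, pos]⟩
  | fork h p A O ihA ihO =>
    obtain ⟨h', hh⟩ := ihA
    exact ⟨h', by simp [leaves, pos, hh]⟩

theorem pot_shift (T : Tree M) (j : ℕ) (h₀ h : ℝ) :
    T.pot j h₀ = gam j * (h - h₀) + T.pot j h := by
  cases T <;> (unfold pot; ring)

/-- Some leaf of the tree has a child. -/
def Alive (ch : M × ℝ → List M) (T : Tree M) : Prop := ∃ z ∈ T.leaves, ch z ≠ []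

theorem alive_fork {ch : M × ℝ → List M} {h : ℝ} {p : M} {A O : Tree M} :
    Alive ch (fork h p A O) ↔ Alive ch A ∨ Alive ch O := by
  simp only [Alive, leaves, Multiset.mem_add, or_and_right, exists_or]

/-! ### Trees in a metric space and bounds on the potential -/

variable [MetricSpace M]

/-- Differences of depths bound distances, in a tree hanging below the point `p` of depth `h₀`. -/
def Valid : Tree M → M → ℝ → Prop
  | leaf h x, p, h₀ => dist p x ≤ h - h₀
  | fork h q A O, p, h₀ => dist p q ≤ h - h₀ ∧ Valid A q h ∧ Valid O q h

theorem Valid.shift {T : Tree M} {p q : M} {h₀ h : ℝ} (hT : T.Valid q h) (hd : dist p q ≤ h - h₀) :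
    T.Valid p h₀ := by
  cases T with
  | leaf h' x =>
    simp only [Valid] at *
    linarith [dist_triangle p q x]
  | fork h' x A O =>
    simp only [Valid] at *
    exact ⟨by linarith [dist_triangle p q x], hT.2⟩

theorem Valid.mk {j : ℕ} {p q : M} {h₀ h : ℝ} {A O : Tree M} (hd : dist p q ≤ h - h₀)
    (hA : A.Valid q h) (hO : O.Valid q h) : (mk j h q A O).Valid p h₀ := by
  unfold Tree.mk
  split_ifs
  · exact ⟨hd, hA, hO⟩
  · exact ⟨hd, hO, hA⟩

theorem Valid.pot_nonneg {T : Tree M} : ∀ {p : M} {h₀ : ℝ}, T.Valid p h₀ → ∀ j, 0 ≤ T.pot j h₀ := by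
  induction T with
  | leaf h x =>
    intro p h₀ hv j
    exact mul_nonneg (by linarith [one_le_gam j]) (dist_nonneg.trans hv)
  | fork h q A O ihA ihO =>
    intro p h₀ hv j
    exact add_nonneg (mul_nonneg (by linarith [one_le_gam j]) (dist_nonneg.trans hv.1))
      (comb_nonneg (eps_nonneg j) (ihA hv.2.1 _) (ihO hv.2.2 _))

theorem Balanced.mk {j : ℕ} {p : M} {h : ℝ} {A O : Tree M} (hA : A.Balanced (j - 1))
    (hO : O.Balanced (j - 1)) (hvA : A.Valid p h) : (mk j h p A O).Balanced j := by
  unfold Tree.mk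
  split_ifs with hc
  · exact ⟨hA, hO, hc⟩
  · refine ⟨hO, hA, ?_⟩
    have h1 := hvA.pot_nonneg (j - 1)
    have h2 := eps_nonneg j
    by_contra hn
    have h3 := mul_nonneg h2 h1
    nlinarith [mul_nonneg h2 (show 0 ≤ O.pot (j - 1) h by linarith)]

theorem pot_fork_le_mk {j : ℕ} {p : M} {h h₀ : ℝ} {A O : Tree M}
    (hvO : O.Valid p h) :
    (fork h p A O).pot j h₀ ≤ (mk j h p A O).pot j h₀ := by
  unfold Tree.mk
  split_ifs with hc
  · exact le_rfl
  · have h1 := hvO.pot_nonneg (j - 1)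
    have h2 := comb_swap (eps_nonneg j) h1 (not_le.1 hc)
    have h3 := mul_nonneg (mul_nonneg (eps_nonneg j) (eps_nonneg j)) h1
    simp only [pot]
    linarith

/-- In a balanced tree `le_comb` lets each fork dominate its active branch, so the potential
dominates the length of the active path. -/
theorem dist_pos_le_pot {T : Tree M} : ∀ {p : M} {h₀ : ℝ} {j : ℕ}, T.Valid p h₀ → T.Balanced j →
    dist p T.pos ≤ T.pot j h₀ := by
  induction T with
  | leaf h x =>
    intro p h₀ j hv _
    simp only [Valid, pos, pot] at *
    nlinarith [one_le_gam j, dist_nonneg (x := p) (y := x)]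
  | fork h q A O ihA ihO =>
    intro p h₀ j hv hb
    have h1 := ihA hv.2.1 hb.1
    have h2 := le_comb (eps_nonneg j) (hv.2.1.pot_nonneg (j - 1)) hb.2.2
    have h3 := hv.1
    simp only [pos, pot] at *
    nlinarith [one_le_gam j, dist_nonneg (x := p) (y := q), dist_triangle p q A.pos]

/-- The reward for rising one level. Leaves gain exactly this factor by the choice of `gam`; forks
inherit it from the larger gain of their branches, one level below. -/
theorem pot_succ_ge {T : Tree M} : ∀ {p : M} {h₀ : ℝ} {j : ℕ}, T.Valid p h₀ →
    T.leaves.card ≤ j → (1 + (3 / 4) ^ (j + 1)) * T.pot j h₀ ≤ T.pot (j + 1) h₀ := by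
  induction T with
  | leaf h x =>
    intro p h₀ j hv _
    simp only [pot, gam]
    exact le_of_eq (by ring)
  | fork h q A O ihA ihO =>
    intro p h₀ j hv hj
    simp only [leaves, Multiset.card_add] at hj
    have hA := A.card_leaves_pos
    have hO := O.card_leaves_pos
    -- A fork has at least two leaves, so `j` is positive and the truncated `j - 1` is harmless.
    obtain ⟨i, rfl⟩ : ∃ i, j = i + 1 := ⟨j - 1, by omega⟩
    have h1 := ihA hv.2.1 (j := i) (by omega)
    have h2 := ihO hv.2.2 (j := i) (by omega)
    have hu : (0 : ℝ) ≤ (3 / 4) ^ (i + 1 + 1) := by positivity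
    have hu1 : ((3 : ℝ) / 4) ^ (i + 1 + 1) ≤ 1 := pow_le_one₀ (by norm_num) (by norm_num)
    have hpow : ((3 : ℝ) / 4) ^ (i + 1) = 4 / 3 * (3 / 4) ^ (i + 1 + 1) := by ring
    have he : eps (i + 1) = (3 / 4) ^ (i + 1 + 1) / 6 := by unfold eps; ring
    have he' : eps (i + 1 + 1) = (3 / 4) ^ (i + 1 + 1) / 8 := rfl
    have h3 := one_add_mul_comb_le hu hu1 (hv.2.1.pot_nonneg i) (hv.2.2.pot_nonneg i)
      (hpow ▸ h1) (hpow ▸ h2)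
    simp only [pot, Nat.add_sub_cancel]
    rw [he, he', gam.eq_2 (i + 1)]
    linarith

/-- A fork costs less than what remains after the removal of one of its branches. -/
theorem comb_le_pot_succ {T : Tree M} {p : M} {h : ℝ} {j : ℕ} (hv : T.Valid p h)
    (hj : T.leaves.card ≤ j) {c : ℝ} (hc : c ≤ (1 + 5 / 2 * eps (j + 1)) * T.pot j h) :
    c ≤ T.pot (j + 1) h := by
  have h1 := pot_succ_ge hv hj
  have h2 := hv.pot_nonneg j
  have h3 : (0 : ℝ) ≤ (3 / 4) ^ (j + 1) := by positivity
  unfold eps at hc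
  nlinarith [mul_nonneg h3 h2]

theorem comb_pot_le_left {A O : Tree M} {p : M} {h : ℝ} {j : ℕ} (hA : A.Valid p h) :
    comb (eps (j + 1)) (A.pot j h) (O.pot j h) ≤ (1 + 5 / 2 * eps (j + 1)) * A.pot j h :=
  comb_le_left (eps_nonneg _) ((eps_le _).trans (by norm_num)) (hA.pot_nonneg _)

theorem comb_pot_le_right {A O : Tree M} {p : M} {h : ℝ} {j : ℕ} (hO : O.Valid p h) :
    comb (eps (j + 1)) (A.pot j h) (O.pot j h) ≤ (1 + 5 / 2 * eps (j + 1)) * O.pot j h :=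
  comb_le_right (eps_nonneg _) (hO.pot_nonneg _)

/-- Deleting, at each fork on the way to `z`, the other branch never lowers the potential and leaves
a single leaf. -/
theorem pot_le_of_mem_leaves {T : Tree M} : ∀ {p : M} {h₀ : ℝ} {j : ℕ}, T.Valid p h₀ →
    T.leaves.card ≤ j → ∀ z ∈ T.leaves, T.pot j h₀ ≤ gam j * (z.2 - h₀) := by
  induction T with
  | leaf h x =>
    intro p h₀ j hv _ z hz
    simp only [leaves, Multiset.mem_singleton] at hz
    subst hz
    exact le_rfl
  | fork h q A O ihA ihO =>
    intro p h₀ j hv hj z hz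
    simp only [leaves, Multiset.card_add, Multiset.mem_add] at hj hz
    have hA := A.card_leaves_pos
    have hO := O.card_leaves_pos
    obtain ⟨i, rfl⟩ : ∃ i, j = i + 1 := ⟨j - 1, by omega⟩
    simp only [pot, Nat.add_sub_cancel]
    rcases hz with hz | hz
    · have h1 := comb_le_pot_succ hv.2.1 (by omega) (comb_pot_le_left (O := O) (j := i) hv.2.1)
      linarith [ihA hv.2.1 (j := i + 1) (by omega) z hz]
    · have h1 := comb_le_pot_succ hv.2.2 (by omega) (comb_pot_le_right (A := A) (j := i) hv.2.2)
      linarith [ihO hv.2.2 (j := i + 1) (by omega) z hz]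

/-! ### Updating a tree -/

/-- A tree whose leaves are the given children of the point `x` at depth `h`. -/
noncomputable def build (h : ℝ) (x : M) : M → List M → ℕ → Tree M
  | y, [], _ => leaf (h + dist x y) y
  | y, z :: l, j => mk j h x (leaf (h + dist x y) y) (build h x z l (j - 1))

open Classical in
/-- Replaces each leaf by its children, removes the branches without children, and switches the
active branches such that the tree is balanced at level `j`. -/
noncomputable def step (ch : M × ℝ → List M) : Tree M → ℕ → Tree M
  | leaf h x, j =>
    match ch (x, h) with
    | [] => leaf h x
    | y :: l => build h x y l j
  | fork h p A O, j =>
    if Alive ch O then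
      -- A surviving branch is updated at level `j`, not `j - 1`: it takes the place of the fork.
      if Alive ch A then mk j h p (step ch A (j - 1)) (step ch O (j - 1)) else step ch O j
    else step ch A j

/-- The leaves that replace the leaf `z`. -/
noncomputable def children (ch : M × ℝ → List M) (z : M × ℝ) : Multiset (M × ℝ) :=
  ((ch z : Multiset M)).map fun y => (y, z.2 + dist z.1 y)

theorem leaves_build (h : ℝ) (x y : M) (l : List M) (j : ℕ) :
    (build h x y l j).leaves = ((y :: l : List M) : Multiset M).map fun y => (y, h + dist x y) := by
  induction l generalizing y j with
  | nil => simp [build, leaves]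
  | cons z l ih =>
    rw [build, leaves_mk, ih, ← Multiset.cons_coe y, Multiset.map_cons, ← Multiset.singleton_add]
    rfl

theorem bind_eq_zero_of_not_alive {ch : M × ℝ → List M} {T : Tree M} (hT : ¬ Alive ch T) :
    T.leaves.bind (children ch) = 0 := by
  simp only [Alive, not_exists, not_and, not_not] at hT
  refine Multiset.eq_zero_of_forall_notMem fun w hw => ?_
  obtain ⟨z, hz, hw⟩ := Multiset.mem_bind.1 hw
  simp [children, hT z hz] at hw

theorem leaves_step {ch : M × ℝ → List M} {T : Tree M} : ∀ {j : ℕ}, Alive ch T →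
    (step ch T j).leaves = T.leaves.bind (children ch) := by
  induction T with
  | leaf h x =>
    intro j hT
    simp only [Alive, leaves, Multiset.mem_singleton, exists_eq_left] at hT
    obtain ⟨y, l, hl⟩ := List.exists_cons_of_ne_nil hT
    simp [step, hl, leaves_build, leaves, children]
  | fork h p A O ihA ihO =>
    intro j hT
    rw [alive_fork] at hT
    rw [step, leaves, Multiset.add_bind]
    split_ifs with hO hA
    · rw [leaves_mk, ihA hA, ihO hO]
    · rw [ihO hO, bind_eq_zero_of_not_alive hA, zero_add]
    · rw [ihA (hT.resolve_right hO), bind_eq_zero_of_not_alive hO, add_zero]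

theorem valid_build (h : ℝ) (x y : M) (l : List M) (j : ℕ) : (build h x y l j).Valid x h := by
  induction l generalizing y j with
  | nil => simp [build, Valid]
  | cons z l ih => exact Valid.mk (by simp) (by simp [Valid]) (ih _ _)

theorem balanced_build (h : ℝ) (x y : M) (l : List M) (j : ℕ) : (build h x y l j).Balanced j := by
  induction l generalizing y j with
  | nil => simp [build, Balanced]
  | cons z l ih => exact Balanced.mk (by simp [Balanced]) (ih _ _) (p := x) (by simp [Valid])

theorem valid_step {ch : M × ℝ → List M} {T : Tree M} : ∀ {p : M} {h₀ : ℝ} {j : ℕ},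
    T.Valid p h₀ → (step ch T j).Valid p h₀ := by
  induction T with
  | leaf h x =>
    intro p h₀ j hv
    rw [step]
    split
    · exact hv
    · exact (valid_build _ _ _ _ _).shift hv
  | fork h q A O ihA ihO =>
    intro p h₀ j hv
    rw [step]
    split_ifs
    · exact Valid.mk hv.1 (ihA hv.2.1) (ihO hv.2.2)
    · exact (ihO hv.2.2).shift hv.1
    · exact (ihA hv.2.1).shift hv.1

theorem balanced_step {ch : M × ℝ → List M} {T : Tree M} : ∀ {p : M} {h₀ : ℝ} {j : ℕ},
    T.Valid p h₀ → (step ch T j).Balanced j := by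
  induction T with
  | leaf h x =>
    intro p h₀ j _
    rw [step]
    split
    · exact trivial
    · exact balanced_build _ _ _ _ _
  | fork h q A O ihA ihO =>
    intro p h₀ j hv
    rw [step]
    split_ifs
    · exact Balanced.mk (ihA hv.2.1) (ihO hv.2.2) (valid_step hv.2.1)
    · exact ihO hv.2.2
    · exact ihA hv.2.1

theorem pot_le_step {ch : M × ℝ → List M} {T : Tree M} : ∀ {p : M} {h₀ : ℝ} {j : ℕ},
    T.Valid p h₀ → T.leaves.card ≤ j → T.pot j h₀ ≤ (step ch T j).pot j h₀ := by
  induction T with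
  | leaf h x =>
    intro p h₀ j hv _
    rw [step]
    split
    · exact le_rfl
    · rename_i y l _
      rw [pot_shift (build h x y l j) j h₀ h, pot]
      linarith [(valid_build h x y l j).pot_nonneg j]
  | fork h q A O ihA ihO =>
    intro p h₀ j hv hj
    simp only [leaves, Multiset.card_add] at hj
    have hA := A.card_leaves_pos
    have hO := O.card_leaves_pos
    obtain ⟨i, rfl⟩ : ∃ i, j = i + 1 := ⟨j - 1, by omega⟩
    rw [step]
    split_ifs
    · refine le_trans ?_ (pot_fork_le_mk (valid_step hv.2.2))
      simp only [pot, Nat.add_sub_cancel]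
      have := comb_mono (eps_nonneg (i + 1)) (ihA hv.2.1 (j := i) (by omega))
        (ihO hv.2.2 (j := i) (by omega))
      linarith
    · rw [pot_shift (step ch O (i + 1)) (i + 1) h₀ h, pot]
      have := comb_le_pot_succ hv.2.2 (by omega) (comb_pot_le_right (A := A) (j := i) hv.2.2)
      have := ihO hv.2.2 (j := i + 1) (by omega)
      simp only [Nat.add_sub_cancel]
      linarith
    · rw [pot_shift (step ch A (i + 1)) (i + 1) h₀ h, pot]
      have := comb_le_pot_succ hv.2.1 (by omega) (comb_pot_le_left (O := O) (j := i) hv.2.1)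
      have := ihA hv.2.1 (j := i + 1) (by omega)
      simp only [Nat.add_sub_cancel]
      linarith

/-! ### Movement against growth of the potential -/

/-- The fork had value `c` and the survivor ends at `g`; the player moves at most `c + g` through
the point of the fork. The growth is at least `11 / 16 * (3/4) ^ (i + 1) * l`, and `2 * (3/4) ≥ 1`.
-/
theorem add_le_of_removal {i : ℕ} {c l g : ℝ} (hl : 0 ≤ l)
    (hc : c ≤ (1 + 5 / 2 * eps (i + 1)) * l) (hg : (1 + (3 / 4) ^ (i + 1)) * l ≤ g) :
    c + g ≤ 192 * 2 ^ (i + 1) * (g - c) := by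
  unfold eps at hc
  have hu0 : (0 : ℝ) ≤ (3 / 4) ^ (i + 1) := by positivity
  have hu1 : ((3 : ℝ) / 4) ^ (i + 1) ≤ 1 := pow_le_one₀ (by norm_num) (by norm_num)
  have hW : (1 : ℝ) ≤ 2 ^ (i + 1) := one_le_pow₀ (by norm_num)
  have hWu : (1 : ℝ) ≤ 2 ^ (i + 1) * (3 / 4) ^ (i + 1) := by
    rw [← mul_pow]
    exact one_le_pow₀ (by norm_num)
  generalize ((3 : ℝ) / 4) ^ (i + 1) = u at *
  generalize (2 : ℝ) ^ (i + 1) = W at *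
  have h1 := mul_le_mul_of_nonneg_left hc (show 0 ≤ 192 * W + 1 by linarith)
  have h2 := mul_le_mul_of_nonneg_left hg (show 0 ≤ 192 * W - 1 by linarith)
  have h3 := mul_le_mul_of_nonneg_right hWu hl
  have h4 := mul_le_mul_of_nonneg_right hu1 hl
  nlinarith

/-- The move through the point of the fork costs at most `a + o' ≤ 3 * o'`, while `comb_swap` gains
`eps ^ 2 * o'`. As `64 * 2 ^ j * eps j ^ 2 = (9/8) ^ j ≥ 1`, the constant `192 = 3 * 64` suffices.
-/
theorem add_le_of_swap {i : ℕ} {a o a' o' : ℝ} (ho : 0 ≤ o)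
    (h : a ≤ (1 + eps (i + 1)) * o) (haa : a ≤ a') (hoo : o ≤ o')
    (h' : (1 + eps (i + 1)) * o' < a') :
    a + o' ≤ 192 * 2 ^ (i + 1) * (comb (eps (i + 1)) o' a' - comb (eps (i + 1)) a o) := by
  have h0 := eps_nonneg (i + 1)
  have h1 := eps_le (i + 1)
  have h2 := comb_swap h0 (ho.trans hoo) h'
  have h3 := comb_mono h0 haa hoo
  have hW : (1 : ℝ) ≤ 64 * (2 ^ (i + 1) * (eps (i + 1) * eps (i + 1))) := by
    have : 64 * ((2 : ℝ) ^ (i + 1) * (eps (i + 1) * eps (i + 1))) = (9 / 8) ^ (i + 1) := by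
      unfold eps
      rw [show (9 / 8 : ℝ) = 2 * (3 / 4 * (3 / 4)) by norm_num, mul_pow, mul_pow]
      ring
    rw [this]
    exact one_le_pow₀ (by norm_num)
  have h4 := mul_le_mul_of_nonneg_right hW (ho.trans hoo)
  have h5 : 192 * 2 ^ (i + 1) * (eps (i + 1) * eps (i + 1) * o')
      ≤ 192 * 2 ^ (i + 1) * (comb (eps (i + 1)) o' a' - comb (eps (i + 1)) a o) :=
    mul_le_mul_of_nonneg_left (by linarith) (by positivity)
  nlinarith

/-- After the step the active value is not capped, so at least half of its growth reaches the fork;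
the doubled constant absorbs this. -/
theorem le_comb_sub {i : ℕ} {d a o a' o' : ℝ} (haa : a ≤ a')
    (hoo : o ≤ o') (h' : a' ≤ (1 + eps (i + 1)) * o') (hd : d ≤ 192 * 2 ^ i * (a' - a)) :
    d ≤ 192 * 2 ^ (i + 1) * (comb (eps (i + 1)) a' o' - comb (eps (i + 1)) a o) := by
  refine hd.trans ?_
  rw [pow_succ]
  have h0 := eps_nonneg (i + 1)
  have h1 : min a ((1 + eps (i + 1)) * o) ≤ a := min_le_left _ _
  have h2 : min o ((1 + eps (i + 1)) * a) ≤ min o' ((1 + eps (i + 1)) * a') :=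
    min_le_min hoo (mul_le_mul_of_nonneg_left haa (by linarith))
  have h3 := mul_le_mul_of_nonneg_left h2 h0
  have h4 : (a' - a) / 2 ≤ comb (eps (i + 1)) a' o' - comb (eps (i + 1)) a o := by
    unfold comb
    rw [min_eq_left h']
    linarith
  have := mul_le_mul_of_nonneg_left h4 (show (0 : ℝ) ≤ 192 * (2 ^ i * 2) by positivity)
  linarith

/-- The distance to the new position is paid for by the growth of the potential. -/
theorem dist_pos_step_le {ch : M × ℝ → List M} {T : Tree M} : ∀ {p : M} {h₀ : ℝ} {j : ℕ},
    T.Valid p h₀ → T.Balanced j → T.leaves.card ≤ j → Alive ch T →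
    (step ch T j).leaves.card ≤ j →
    dist T.pos (step ch T j).pos ≤ 192 * 2 ^ j * ((step ch T j).pot j h₀ - T.pot j h₀) := by
  induction T with
  | leaf h x =>
    intro p h₀ j hv _ _ hT _
    simp only [Alive, leaves, Multiset.mem_singleton, exists_eq_left] at hT
    obtain ⟨y, l, hl⟩ := List.exists_cons_of_ne_nil hT
    simp only [step, hl, pos]
    rw [pot_shift (build h x y l j) j h₀ h, pot]
    have h1 := dist_pos_le_pot (valid_build h x y l j) (balanced_build h x y l j)
    have h2 := (valid_build h x y l j).pot_nonneg j
    have hW : (1 : ℝ) ≤ 2 ^ j := one_le_pow₀ (by norm_num)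
    nlinarith
  | fork h q A O ihA ihO =>
    intro p h₀ j hv hb hj hT hj'
    have hAv := hv.2.1
    have hOv := hv.2.2
    simp only [leaves, Multiset.card_add] at hj
    have hA := A.card_leaves_pos
    have hO := O.card_leaves_pos
    obtain ⟨i, rfl⟩ : ∃ i, j = i + 1 := ⟨j - 1, by omega⟩
    obtain ⟨hAb, hOb, hab⟩ := hb
    simp only [Nat.add_sub_cancel] at hAb hOb hab
    have hdA := dist_pos_le_pot hAv hAb
    rw [alive_fork] at hT
    -- Common to the deaths of either branch: `B` survives, and both positions are compared with the
    -- point `q` of the fork.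
    have hremoval : ∀ B : Tree M, B.Valid q h → B.leaves.card ≤ i →
        comb (eps (i + 1)) (A.pot i h) (O.pot i h) ≤ (1 + 5 / 2 * eps (i + 1)) * B.pot i h →
        dist A.pos (step ch B (i + 1)).pos ≤ 192 * 2 ^ (i + 1) *
          ((step ch B (i + 1)).pot (i + 1) h₀ - (fork h q A O).pot (i + 1) h₀) := by
      intro B hBv hBi hB
      rw [pot_shift (step ch B (i + 1)) (i + 1) h₀ h, pot, Nat.add_sub_cancel,
        add_sub_add_left_eq_sub]
      have h1 := add_le_of_removal (hBv.pot_nonneg i) hB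
        ((pot_succ_ge hBv hBi).trans (pot_le_step (ch := ch) hBv (by omega)))
      have h2 := dist_pos_le_pot (valid_step (ch := ch) hBv (j := i + 1)) (balanced_step hBv)
      have h3 := le_comb (eps_nonneg (i + 1)) (hAv.pot_nonneg i) hab
      linarith [dist_triangle_left A.pos (step ch B (i + 1)).pos q]
    rw [step] at hj' ⊢
    split_ifs at hj' ⊢ with hOa hAa
    · rw [Nat.add_sub_cancel, leaves_mk, Multiset.card_add] at hj'
      have hA' := (step ch A i).card_leaves_pos
      have hO' := (step ch O i).card_leaves_pos
      have hpA := pot_le_step (ch := ch) hAv (j := i) (by omega)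
      have hpO := pot_le_step (ch := ch) hOv (j := i) (by omega)
      have hdO := dist_pos_le_pot (valid_step (ch := ch) hOv (j := i)) (balanced_step hOv)
      have hd := ihA hAv hAb (by omega) hAa (by omega)
      simp only [mk, Nat.add_sub_cancel]
      split_ifs with hc
      · simp only [pos, pot, Nat.add_sub_cancel, add_sub_add_left_eq_sub]
        exact le_comb_sub hpA hpO hc hd
      · simp only [pos, pot, Nat.add_sub_cancel, add_sub_add_left_eq_sub]
        have := add_le_of_swap (hOv.pot_nonneg i) hab hpA hpO (not_le.1 hc)
        linarith [dist_triangle_left A.pos (step ch O i).pos q]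
    · exact hremoval O hOv (by omega) (comb_pot_le_right hOv)
    · exact hremoval A hAv (by omega) (comb_pot_le_left hAv)

/-! ### Attaching the requested points -/

theorem exists_parent (T : Tree M) (y : M) :
    ∃ z ∈ T.leaves, ∀ w ∈ T.leaves, z.2 + dist z.1 y ≤ w.2 + dist w.1 y := by
  classical
  obtain ⟨h, hh⟩ := T.exists_leaf_pos
  obtain ⟨z, hz, hm⟩ := Finset.exists_min_image T.leaves.toFinset
    (fun z => z.2 + dist z.1 y) ⟨_, Multiset.mem_toFinset.2 hh⟩
  exact ⟨z, Multiset.mem_toFinset.1 hz, fun w hw => hm w (Multiset.mem_toFinset.2 hw)⟩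

/-- The leaf from which `y` is reached at the least total depth. -/
noncomputable def parent (T : Tree M) (y : M) : M × ℝ := (T.exists_parent y).choose

theorem parent_mem (T : Tree M) (y : M) : T.parent y ∈ T.leaves :=
  (T.exists_parent y).choose_spec.1

theorem parent_le (T : Tree M) (y : M) {w : M × ℝ} (hw : w ∈ T.leaves) :
    (T.parent y).2 + dist (T.parent y).1 y ≤ w.2 + dist w.1 y :=
  (T.exists_parent y).choose_spec.2 w hw

open Classical in
/-- The requested points whose parent is `z`. -/
noncomputable def requestChildren (T : Tree M) (S : Finset M) (z : M × ℝ) : List M :=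
  S.toList.filter fun y => T.parent y = z

theorem mem_requestChildren {T : Tree M} {S : Finset M} {z : M × ℝ} {y : M} :
    y ∈ T.requestChildren S z ↔ y ∈ S ∧ T.parent y = z := by
  simp [requestChildren]

/-- The tree after the request `S`. -/
noncomputable def update (k : ℕ) (T : Tree M) (S : Finset M) : Tree M :=
  step (T.requestChildren S) T k

theorem alive_requestChildren (T : Tree M) {S : Finset M} (hS : S.Nonempty) :
    Alive (T.requestChildren S) T := by
  obtain ⟨y, hy⟩ := hS
  exact ⟨T.parent y, T.parent_mem y, List.ne_nil_of_mem (mem_requestChildren.2 ⟨hy, rfl⟩)⟩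

theorem leaves_update (k : ℕ) (T : Tree M) {S : Finset M} (hS : S.Nonempty) :
    (update k T S).leaves = T.leaves.bind (children (T.requestChildren S)) :=
  leaves_step (T.alive_requestChildren hS)

theorem fst_mem_of_mem_leaves_update {k : ℕ} {T : Tree M} {S : Finset M} (hS : S.Nonempty)
    {z : M × ℝ} (hz : z ∈ (update k T S).leaves) : z.1 ∈ S := by
  rw [leaves_update k T hS, Multiset.mem_bind] at hz
  obtain ⟨w, _, hz⟩ := hz
  obtain ⟨y, hy, rfl⟩ := Multiset.mem_map.1 hz
  exact (mem_requestChildren.1 (Multiset.mem_coe.1 hy)).1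

theorem pos_update_mem (k : ℕ) (T : Tree M) {S : Finset M} (hS : S.Nonempty) :
    (update k T S).pos ∈ S := by
  obtain ⟨h, hh⟩ := (update k T S).exists_leaf_pos
  exact fst_mem_of_mem_leaves_update hS hh

theorem exists_mem_leaves_update {k : ℕ} {T : Tree M} {S : Finset M} {w : M × ℝ}
    (hw : w ∈ T.leaves) {y : M} (hy : y ∈ S) :
    ∃ h ≤ w.2 + dist w.1 y, (y, h) ∈ (update k T S).leaves := by
  refine ⟨_, T.parent_le y hw, ?_⟩
  rw [leaves_update k T ⟨y, hy⟩, Multiset.mem_bind]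
  exact ⟨_, T.parent_mem y, Multiset.mem_map.2
    ⟨y, Multiset.mem_coe.2 (mem_requestChildren.2 ⟨hy, rfl⟩), rfl⟩⟩

/-- Each requested point has a single parent, and that leaf occurs only once. So there are never
more leaves than requested points. -/
theorem map_fst_leaves_update {k : ℕ} {T : Tree M} (hT : T.leaves.Nodup) {S : Finset M}
    (hS : S.Nonempty) : (update k T S).leaves.map Prod.fst = S.val := by
  have h1 : (update k T S).leaves.map Prod.fst
      = T.leaves.bind fun z => (T.requestChildren S z : Multiset M) := by
    rw [leaves_update k T hS, Multiset.map_bind]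
    simp [children, Function.comp_def]
  rw [h1, Multiset.Nodup.ext _ S.nodup]
  · intro y
    simp only [Multiset.mem_bind, Multiset.mem_coe, mem_requestChildren, Finset.mem_val]
    exact ⟨fun ⟨_, _, hy, _⟩ => hy, fun hy => ⟨_, T.parent_mem y, hy, rfl⟩⟩
  · rw [Multiset.nodup_bind]
    refine ⟨fun z _ => Multiset.coe_nodup.2 (S.nodup_toList.filter _), ?_⟩
    refine hT.pairwise fun z _ w _ hne => ?_
    rw [Function.onFun, Multiset.disjoint_left]
    intro y hy hy'
    rw [Multiset.mem_coe, mem_requestChildren] at hy hy'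
    exact hne (hy.2.symm.trans hy'.2)

/-- The tree after the requests in the list `l`. -/
noncomputable def ofRequests (k : ℕ) (s₀ : M) (l : List (Finset M)) : Tree M :=
  l.foldl (update k) (leaf 0 s₀)

theorem ofRequests_append (k : ℕ) (s₀ : M) (l : List (Finset M)) (S : Finset M) :
    ofRequests k s₀ (l ++ [S]) = update k (ofRequests k s₀ l) S := by
  simp [ofRequests]

end Tree

/-! ### Sequences of requests and path costs -/

variable {M : Type*}

/-- The first `n` requests of the sequence `σ`. -/
def firstRequests (σ : ℕ → Finset M) (n : ℕ) : List (Finset M) := (List.range n).map σ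

theorem firstRequests_succ (σ : ℕ → Finset M) (n : ℕ) :
    firstRequests σ (n + 1) = firstRequests σ n ++ [σ n] := by
  simp [firstRequests, List.range_succ]

/-- The greatest cardinality in a list of requests, and at least `1`. -/
def maxCard (l : List (Finset M)) : ℕ := l.foldl (fun n S => max n S.card) 1

theorem maxCard_append (l : List (Finset M)) (S : Finset M) :
    maxCard (l ++ [S]) = max (maxCard l) S.card := by
  simp [maxCard]

theorem one_le_maxCard_firstRequests (σ : ℕ → Finset M) (n : ℕ) :
    1 ≤ maxCard (firstRequests σ n) := by
  induction n with
  | zero => simp [firstRequests, maxCard]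
  | succ n ih =>
    rw [firstRequests_succ, maxCard_append]
    exact ih.trans (le_max_left _ _)

theorem card_le_maxCard_firstRequests (σ : ℕ → Finset M) {i n : ℕ} (hi : i < n) :
    (σ i).card ≤ maxCard (firstRequests σ n) := by
  induction n with
  | zero => omega
  | succ n ih =>
    rw [firstRequests_succ, maxCard_append]
    rcases Nat.lt_succ_iff_lt_or_eq.1 hi with h | rfl
    · exact (ih h).trans (le_max_left _ _)
    · exact le_max_right _ _

theorem maxCard_firstRequests_le {σ : ℕ → Finset M} {k : ℕ} (hk : 1 ≤ k)
    (hσ : ∀ i, (σ i).card ≤ k) (n : ℕ) : maxCard (firstRequests σ n) ≤ k := by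
  induction n with
  | zero => simpa [firstRequests, maxCard] using hk
  | succ n ih =>
    rw [firstRequests_succ, maxCard_append]
    exact max_le ih (hσ n)

variable [MetricSpace M]

/-- The distance travelled in the first `n` steps. -/
noncomputable def pathCost (x : ℕ → M) (n : ℕ) : ℝ :=
  ∑ i ∈ Finset.range n, dist (x i) (x (i + 1))

theorem pathCost_succ (x : ℕ → M) (n : ℕ) :
    pathCost x (n + 1) = pathCost x n + dist (x n) (x (n + 1)) :=
  Finset.sum_range_succ _ _

theorem dist_le_pathCost (x : ℕ → M) (n : ℕ) : dist (x 0) (x n) ≤ pathCost x n :=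
  dist_le_range_sum_dist x n

theorem pathCost_nonneg (x : ℕ → M) (n : ℕ) : 0 ≤ pathCost x n :=
  dist_nonneg.trans (dist_le_pathCost x n)

/-! ### Known bound on the cardinalities -/

/-- The trajectory of the algorithm for requests of cardinality at most `k`. -/
noncomputable def fixedPath (k : ℕ) (s₀ : M) (σ : ℕ → Finset M) (n : ℕ) : M :=
  (Tree.ofRequests k s₀ (firstRequests σ n)).pos

theorem fixedPath_zero (k : ℕ) (s₀ : M) (σ : ℕ → Finset M) : fixedPath k s₀ σ 0 = s₀ := rfl

theorem pathCost_fixedPath_le_pot {k : ℕ} (hk : 1 ≤ k) (s₀ : M) {σ : ℕ → Finset M}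
    (hσ : ∀ i, (σ i).Nonempty) {n : ℕ} (hc : ∀ i < n, (σ i).card ≤ k) :
    let T := Tree.ofRequests k s₀ (firstRequests σ n)
    T.Valid s₀ 0 ∧ T.Balanced k ∧ T.leaves.card ≤ k ∧ T.leaves.Nodup ∧
      pathCost (fixedPath k s₀ σ) n ≤ 192 * 2 ^ k * T.pot k 0 := by
  induction n with
  | zero =>
    simp [firstRequests, Tree.ofRequests, Tree.Valid, Tree.Balanced, Tree.leaves, pathCost,
      Tree.pot, hk]
  | succ n ih =>
    obtain ⟨hv, hb, hcard, hnd, hcost⟩ := ih fun i hi => hc i (by omega)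
    rw [pathCost_succ]
    simp only [fixedPath]
    rw [firstRequests_succ, Tree.ofRequests_append]
    have hmap := Tree.map_fst_leaves_update (k := k) hnd (hσ n)
    have hcard' : (Tree.update k (Tree.ofRequests k s₀ (firstRequests σ n)) (σ n)).leaves.card
        ≤ k := by
      rw [← Multiset.card_map Prod.fst, hmap]
      exact hc n (by omega)
    refine ⟨Tree.valid_step hv, Tree.balanced_step hv, hcard', ?_, ?_⟩
    · refine Multiset.Nodup.of_map Prod.fst ?_
      rw [hmap]
      exact (σ n).nodup
    · have := Tree.dist_pos_step_le hv hb hcard (Tree.alive_requestChildren _ (hσ n)) hcard'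
      unfold Tree.update
      linarith

/-- A parent minimises the new depth, so leaf depths never exceed the cost of an offline path ending
at the same point. -/
theorem exists_leaf_le_pathCost (k : ℕ) {s₀ : M} {σ : ℕ → Finset M} {x : ℕ → M} (h0 : x 0 = s₀)
    (hx : ∀ i, x (i + 1) ∈ σ i) (n : ℕ) :
    ∃ h ≤ pathCost x n, (x n, h) ∈ (Tree.ofRequests k s₀ (firstRequests σ n)).leaves := by
  induction n with
  | zero => exact ⟨0, by simp [pathCost], by simp [firstRequests, Tree.ofRequests, Tree.leaves, h0]⟩
  | succ n ih =>
    obtain ⟨h, hh, hmem⟩ := ih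
    obtain ⟨h', hh', hmem'⟩ := Tree.exists_mem_leaves_update (k := k) hmem (hx n)
    rw [firstRequests_succ, Tree.ofRequests_append, pathCost_succ]
    exact ⟨h', by simp only at hh'; linarith, hmem'⟩

/-- The constant in the competitive ratio for a known bound on the cardinalities. -/
noncomputable def ratio : ℝ := 192 * Real.exp 3

theorem ratio_pos : 0 < ratio := by unfold ratio; positivity

theorem pathCost_fixedPath_le {k : ℕ} (hk : 1 ≤ k) {s₀ : M} {σ : ℕ → Finset M} {x : ℕ → M}
    (h0 : x 0 = s₀) (hx : ∀ i, x (i + 1) ∈ σ i) {n : ℕ} (hc : ∀ i < n, (σ i).card ≤ k) :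
    pathCost (fixedPath k s₀ σ) n ≤ ratio * 2 ^ k * pathCost x n := by
  obtain ⟨hv, -, hcard, -, hcost⟩ := pathCost_fixedPath_le_pot hk s₀ (fun i => ⟨_, hx i⟩) hc
  obtain ⟨h, hh, hmem⟩ := exists_leaf_le_pathCost k h0 hx n
  have h1 := Tree.pot_le_of_mem_leaves hv hcard _ hmem
  simp only [sub_zero] at h1
  have h2 : gam k * h ≤ Real.exp 3 * pathCost x n :=
    (mul_le_mul_of_nonneg_left hh (by linarith [one_le_gam k])).trans
      (mul_le_mul_of_nonneg_right (gam_le k) (pathCost_nonneg x n))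
  calc _ ≤ _ := hcost
    _ ≤ 192 * 2 ^ k * (Real.exp 3 * pathCost x n) :=
      mul_le_mul_of_nonneg_left (h1.trans h2) (by positivity)
    _ = _ := by unfold ratio; ring

/-! ### Unknown bound on the cardinalities -/

/-- The online algorithm: it follows the algorithm for the greatest cardinality seen so far. -/
noncomputable def chaser (M : Type*) [MetricSpace M] : OnlineAlgorithm M where
  next s₀ past S := (Tree.ofRequests (maxCard (past ++ [S])) s₀ (past ++ [S])).pos
  next_mem s₀ past S hS := by
    rw [Tree.ofRequests_append]
    exact Tree.pos_update_mem _ _ hS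

/-- The trajectory of the online algorithm. -/
noncomputable def chaserPath (s₀ : M) (σ : ℕ → Finset M) (n : ℕ) : M :=
  fixedPath (maxCard (firstRequests σ n)) s₀ σ n

/-- The first term pays for all past changes of algorithm, the second for the algorithm now
followed, as if it had run from the start. -/
theorem pathCost_chaserPath_le {s₀ : M} {σ : ℕ → Finset M} {x : ℕ → M}
    (h0 : x 0 = s₀) (hx : ∀ i, x (i + 1) ∈ σ i) (n : ℕ) :
    pathCost (chaserPath s₀ σ) n ≤ 2 * ratio * 2 ^ maxCard (firstRequests σ n) * pathCost x n
      + pathCost (fixedPath (maxCard (firstRequests σ n)) s₀ σ) n := by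
  have hr := ratio_pos
  induction n with
  | zero => simp [pathCost]
  | succ n ih =>
    have h1 : 1 ≤ maxCard (firstRequests σ n) := one_le_maxCard_firstRequests σ n
    have hb := pathCost_fixedPath_le h1 h0 hx
      (fun i (hi : i < n) => card_le_maxCard_firstRequests σ hi)
    have hx0 := pathCost_nonneg x n
    have hx1 : pathCost x n ≤ pathCost x (n + 1) := by
      rw [pathCost_succ]
      exact le_add_of_nonneg_right dist_nonneg
    have hle : maxCard (firstRequests σ n) ≤ maxCard (firstRequests σ (n + 1)) := by
      rw [firstRequests_succ, maxCard_append]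
      exact le_max_left _ _
    rw [pathCost_succ (chaserPath s₀ σ)]
    simp only [chaserPath] at ih ⊢
    generalize maxCard (firstRequests σ n) = κ at *
    generalize maxCard (firstRequests σ (n + 1)) = κ' at *
    have hX : 2 * ratio * 2 ^ κ' * pathCost x n ≤ 2 * ratio * 2 ^ κ' * pathCost x (n + 1) :=
      mul_le_mul_of_nonneg_left hx1 (by positivity)
    rcases hle.eq_or_lt with rfl | hlt
    · rw [pathCost_succ (fixedPath κ s₀ σ)]
      linarith
    -- Changing from `κ` to `κ'` costs at most both path costs, through `s₀`. The abandoned path is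
    -- then paid twice, and `2 * ratio * 2 ^ κ` more is what doubling the first term provides.
    · have h2 : (2 : ℝ) ^ (κ + 1) ≤ 2 ^ κ' := pow_le_pow_right₀ (by norm_num) hlt
      have h3 : 2 * ratio * 2 ^ (κ + 1) * pathCost x n ≤ 2 * ratio * 2 ^ κ' * pathCost x n := by
        gcongr
      have h4 := dist_le_pathCost (fixedPath κ s₀ σ) n
      have h5 := dist_le_pathCost (fixedPath κ' s₀ σ) (n + 1)
      rw [fixedPath_zero] at h4 h5
      have h6 := dist_triangle_left (fixedPath κ s₀ σ n) (fixedPath κ' s₀ σ (n + 1)) s₀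
      rw [pow_succ] at h3
      linarith

/-! ### Passage to finite sequences of requests -/

theorem travelCost_eq_pathCost {T : ℕ} {x : Fin (T + 1) → M} {y : ℕ → M}
    (h : ∀ i : Fin (T + 1), x i = y i) : travelCost x = pathCost y T := by
  unfold travelCost pathCost
  rw [← Fin.sum_univ_eq_sum_range (fun i => dist (y i) (y (i + 1)))]
  simp [h]

theorem run_chaser_eq {T : ℕ} (s₀ : M) {S : Fin T → Finset M} {σ : ℕ → Finset M}
    (h : ∀ t : Fin T, S t = σ t) (i : Fin (T + 1)) :
    (chaser M).run s₀ S i = chaserPath s₀ σ i := by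
  have htake : ∀ t : Fin T, (List.ofFn S).take t = firstRequests σ t := by
    intro t
    refine List.ext_getElem (by simp [firstRequests, t.isLt.le]) fun n h1 h2 => ?_
    simp [firstRequests, h]
  induction i using Fin.cases with
  | zero => rfl
  | succ t =>
    simp only [OnlineAlgorithm.run, Fin.cons_succ, chaser, htake, h, Fin.val_succ, chaserPath,
      fixedPath, firstRequests_succ]

theorem travelCost_run_chaser_le {T k : ℕ} {s₀ : M} {S : Fin T → Finset M}
    (hk : 1 ≤ k) (hS : ∀ t, (S t).card ≤ k) {x : Fin (T + 1) → M} (hx : Serves s₀ S x) :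
    travelCost ((chaser M).run s₀ S) ≤ 3 * ratio * 2 ^ k * travelCost x := by
  have hr := ratio_pos
  let y : ℕ → M := fun n => x ⟨min n T, by omega⟩
  -- Beyond time `T` the offline path rests and the requests are singletons on it, so that it serves
  -- them and `k` still bounds them.
  let σ : ℕ → Finset M := fun n => if h : n < T then S ⟨n, h⟩ else {y (n + 1)}
  have hxy : ∀ i : Fin (T + 1), x i = y i := fun i =>
    congrArg x (Fin.ext (by simp; omega))
  have hSσ : ∀ t : Fin T, S t = σ t := fun t => by simp [σ]
  have hy0 : y 0 = s₀ := by
    rw [← hx.1]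
    exact (hxy 0).symm
  have hy : ∀ i, y (i + 1) ∈ σ i := by
    intro i
    by_cases h : i < T
    · have h1 := hx.2 ⟨i, h⟩
      rw [hxy, hSσ] at h1
      exact h1
    · simp [σ, h]
  have hσ : ∀ i, (σ i).card ≤ k := by
    intro i
    by_cases h : i < T
    · simpa [σ, h] using hS ⟨i, h⟩
    · simpa [σ, h] using hk
  rw [travelCost_eq_pathCost (run_chaser_eq s₀ hSσ), travelCost_eq_pathCost hxy]
  have h1 := pathCost_chaserPath_le hy0 hy T
  have h2 := pathCost_fixedPath_le (one_le_maxCard_firstRequests σ T) hy0 hy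
    (fun i (hi : i < T) => card_le_maxCard_firstRequests σ hi)
  have h3 : (2 : ℝ) ^ maxCard (firstRequests σ T) ≤ 2 ^ k :=
    pow_le_pow_right₀ (by norm_num) (maxCard_firstRequests_le hk hσ T)
  have h4 : 3 * ratio * 2 ^ maxCard (firstRequests σ T) * pathCost y T
      ≤ 3 * ratio * 2 ^ k * pathCost y T := by
    have := pathCost_nonneg y T
    gcongr
  linarith

theorem chaser_isCompetitive (M : Type*) [MetricSpace M] (k : ℕ) :
    (chaser M).IsCompetitive k (3 * ratio * 2 ^ k) := by
  intro s₀ T S hS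
  obtain ⟨⟨x, hx, hopt⟩, -⟩ := offlineOpt_isLeast s₀ S fun t => Finset.card_pos.1 (hS t).1
  rw [← hopt]
  rcases Nat.eq_zero_or_pos T with rfl | hT
  · simp [travelCost]
  · have h := hS ⟨0, hT⟩
    exact travelCost_run_chaser_le (h.1.trans h.2) (fun t => (hS t).2) hx

end SmallSetChasing

theorem theorem1 :
    ∃ C : ℝ, 0 < C ∧ ∀ (M : Type*) [MetricSpace M],
      ∃ A : SmallSetChasing.OnlineAlgorithm M,
        ∀ k : ℕ, A.IsCompetitive k (C * 2 ^ k) :=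
  ⟨3 * SmallSetChasing.ratio, mul_pos (by norm_num) SmallSetChasing.ratio_pos, fun M _ =>
    ⟨SmallSetChasing.chaser M, SmallSetChasing.chaser_isCompetitive M⟩⟩
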